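/- Fix a dimension $d$. A unitary $U$ on $\mathbb{C}^d$ \emph{encodes} a subspace $S\subseteq\mathbb{C}^d$ if $U=I-2\Pi$, where $\Pi$ is the orthogonal projector onto $S$. For an integer $w\ge 1$ with $2w\le d$, the \emph{Approximate Dimension} problem is to decide, given query access to a unitary $U$ that encodes a subspace $S$, whether $\dim S\ge 2w$ (\emph{yes} instances) or $\dim S\le w$ (\emph{no} instances). A \emph{$T$-query algorithm with an $m$-qubit proof} acts on $\mathbb{C}^2\otimes\mathbb{C}^d\otimes\mathbb{C}^r\otimes(\mathbb{C}^2)^{\otimes m}$ (control qubit, query register, work register of an arbitrary finite dimension $r$, proof register). It starts in a fixed computational basis state of the first three registers tensored with the proof state $|\psi\rangle$, applies unitaries $A_0,A_1,\dots,A_T$ that do not depend on $U$, interleaved with $T$ controlled queries, each to $U$ or to $U^{*}$, and finally measures in the computational basis, accepting if the outcome lies in a fixed set. It \emph{solves the problem with the help of the proof} (is a $\mathsf{QMA}$ tester) if for every yes instance $U$ there is a proof state $|\psi\rangle$ on which it accepts with probability at least $2/3$, and for every no instance $U$ it accepts every proof state with probability at most $1/3$. \textbf{Theorem ($\mathsf{QMA}$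 lower bound for Approximate Dimension).} There is a universal constant $c>0$ such that for all integers $d,w,m,T\ge 0$ with $w\ge 1$ and $2w\le d$: if some $T$-query algorithm with an $m$-qubit proof solves the Approximate Dimension problem with parameters $d,w$, then \[ m\ \ge\ c\,w \qquad\text{or}\qquad T\ \ge\ c\,\sqrt{d/w}. \] -/

import Mathlib

/-! Quantum query algorithms with a quantum proof, and the Approximate Dimension problem. -/

namespace QMAQuery

/-- Labels of the computational basis of `ℂ² ⊗ ℂ^d ⊗ (ℂ^r ⊗ (ℂ²)^{⊗ m})`: the control qubit, the
query register, `r`-dimensional work space, and the `m` qubits that hold the proof. -/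
abbrev Label (d m r : ℕ) : Type := Bool × Fin d × Fin r × (Fin m → Bool)

/-- `ψ` is the amplitude vector of a pure state (a unit vector of `ℂ^ι`). -/
def IsState {ι : Type*} [Fintype ι] (ψ : ι → ℂ) : Prop := ∑ x, ‖ψ x‖ ^ 2 = 1

/-- The controlled unitary `cU`: apply `U` to the query register when the control qubit is `1`. -/
def controlled {d m r : ℕ} (U : Matrix.unitaryGroup (Fin d) ℂ) (φ : Label d m r → ℂ) :
    Label d m r → ℂ
  | (true, i, k) => ∑ j : Fin d, (U : Matrix (Fin d) (Fin d) ℂ) i j * φ (true, j, k)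
  | (false, i, k) => φ (false, i, k)

/-- A `T`-query quantum algorithm with an `m`-qubit proof, with access to a `d`-dimensional
unitary `U`: oracle-independent unitaries `A₀, A₁, …, A_T` on all registers, interleaved with `T`
controlled queries, each to `U` or to its inverse, followed by a measurement in the computational
basis. -/
structure Algorithm (d m T : ℕ) where
  /-- dimension of the work space -/
  r : ℕ
  /-- computational basis state in which the control, query and work registers start -/
  start : Bool × Fin d × Fin r
  /-- the oracle-independent unitaries -/
  gate : Fin (T + 1) → Matrix.unitaryGroup (Label d m r) ℂ
  /-- whether a query is made to the inverse `U*` rather than to `U` -/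
  inverse : Fin T → Bool
  /-- the measurement outcomes on which the algorithm accepts -/
  accept : Finset (Label d m r)

namespace Algorithm

variable {d m T : ℕ} (A : Algorithm d m T)

/-- The initial state: fixed basis state on the control, query and work registers, tensored with
the proof `ψ`. -/
def initial (ψ : (Fin m → Bool) → ℂ) : Label d m A.r → ℂ :=
  fun x => if (x.1, x.2.1, x.2.2.1) = A.start then ψ x.2.2.2 else 0

/-- The state right after the unitary `A_t`, that is, after `t` queries. -/
def stateAfter (U : Matrix.unitaryGroup (Fin d) ℂ) (ψ : (Fin m → Bool) → ℂ) :
    (t : ℕ) → t ≤ T → (Label d m A.r → ℂ)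
  | 0, _ => Matrix.mulVec (A.gate 0 : Matrix _ _ ℂ) (A.initial ψ)
  | t + 1, ht =>
      Matrix.mulVec (A.gate ⟨t + 1, Nat.lt_succ_of_le ht⟩ : Matrix _ _ ℂ)
        (controlled (if A.inverse ⟨t, ht⟩ then U⁻¹ else U)
          (stateAfter U ψ t (Nat.le_of_succ_le ht)))

/-- The probability that the algorithm accepts on oracle `U` and proof `ψ`. -/
noncomputable def acceptProb (U : Matrix.unitaryGroup (Fin d) ℂ) (ψ : (Fin m → Bool) → ℂ) : ℝ :=
  ∑ x ∈ A.accept, ‖A.stateAfter U ψ T le_rfl x‖ ^ 2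

/-- The algorithm is a `QMA` tester for the unitary property `(yes, no)`. -/
def IsQMATester (yes no : Set (Matrix.unitaryGroup (Fin d) ℂ)) : Prop :=
  (∀ U ∈ yes, ∃ ψ : (Fin m → Bool) → ℂ, IsState ψ ∧ 2 / 3 ≤ A.acceptProb U ψ) ∧
    (∀ U ∈ no, ∀ ψ : (Fin m → Bool) → ℂ, IsState ψ → A.acceptProb U ψ ≤ 1 / 3)

end Algorithm

/-- `U` encodes the subspace `S`: `U = I - 2 Π` with `Π` the orthogonal projector onto `S`. -/
def Encodes {d : ℕ} (U : Matrix.unitaryGroup (Fin d) ℂ)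
    (S : Submodule ℂ (EuclideanSpace ℂ (Fin d))) : Prop :=
  ∀ v : EuclideanSpace ℂ (Fin d),
    Matrix.toEuclideanLin (U : Matrix (Fin d) (Fin d) ℂ) v = v - (2 : ℂ) • S.starProjection v

/-- Yes instances of Approximate Dimension: encoded subspace of dimension at least `2w`. -/
def approxDimYes (d w : ℕ) : Set (Matrix.unitaryGroup (Fin d) ℂ) :=
  {U | ∃ S : Submodule ℂ (EuclideanSpace ℂ (Fin d)), Encodes U S ∧ 2 * w ≤ Module.finrank ℂ S}

/-- No instances of Approximate Dimension: encoded subspace of dimension at most `w`. -/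
def approxDimNo (d w : ℕ) : Set (Matrix.unitaryGroup (Fin d) ℂ) :=
  {U | ∃ S : Submodule ℂ (EuclideanSpace ℂ (Fin d)), Encodes U S ∧ Module.finrank ℂ S ≤ w}

end QMAQuery

namespace QMAQuery
open Polynomial

/-! Polynomial method. Only diagonal sign oracles, indexed by subsets `S` of the basis, are needed.
After `t` queries the amplitudes have degree at most `t` in the indicators of `S`, so acceptance is
a quadratic form in the proof whose `2^m × 2^m` matrix `M(S)` has entries of degree at most `2T`.
For a fixed amplifying polynomial `f`, let `G(S) = tr f(M(S))^(m+1)`. The trace removes the unknown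
proof at the cost of a factor `2^m`, and polynomials in `M(S)` amplify without extra copies of the
proof (`Algorithm.IsQMATester.exists_lowDegree`).

Averaging `G` over a random `S` with inclusion probability `p` gives a polynomial `P(p)` of degree
`O((m+1)T)`. It is at most `2^m` on `[0,1]`, tiny on `[0,a]` with `a = w/(100d)`, and at least
`2^-(m+2)` at `b = 8w/d` (`bernoulli_average_bounds`).

When `T√(w/d)` is small, the degree times `√b` is a small multiple of `m+1`, and Chebyshev
extremality makes all coefficients of index above `m` negligible on `[0,b]`. There `P` behaves like
a polynomial of degree `m`, which grows by at most `(4b/a)^m = 3200^m` between `a` and `b`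
(`abs_eval_le_of_degree_le`). If `m` is also small compared to `w`, the Chernoff error `32^-w`
survives this growth, so the gap cannot be bridged. -/

/-! ### Growth of bounded real polynomials. -/

lemma iterate_derivative_comp_linear (p : ℝ[X]) (a b : ℝ) (n : ℕ) :
    derivative^[n] (p.comp (C a + C b * X)) =
      C (b ^ n) * (derivative^[n] p).comp (C a + C b * X) := by
  induction n with
  | zero => simp
  | succ n ih =>
    rw [Function.iterate_succ_apply', ih, Function.iterate_succ_apply']
    simp only [derivative_C_mul, derivative_comp, derivative_add, derivative_C, derivative_X,
      zero_add, mul_one, pow_succ, C_mul]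
    ring

lemma natDegree_comp_linear_le (p : ℝ[X]) (a b : ℝ) :
    (p.comp (C a + C b * X)).natDegree ≤ p.natDegree := by
  refine natDegree_comp_le.trans ?_
  have : (C a + C b * X : ℝ[X]).natDegree ≤ 1 := by compute_degree
  calc _ ≤ p.natDegree * 1 := Nat.mul_le_mul_left _ this
    _ = _ := mul_one _

/-- Extremality of the Chebyshev polynomials on `[0, a]`, for derivatives at points outside. -/
lemma abs_iterate_derivative_le {p : ℝ[X]} {D : ℕ} (hD : p.natDegree ≤ D) {M a : ℝ} (hM : 0 < M)
    (ha : 0 < a) (hp : ∀ x ∈ Set.Icc 0 a, |p.eval x| ≤ M) (n : ℕ) (s : ℝ) {y : ℝ} (hy : 1 ≤ y)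
    (hs : s = 1 ∨ s = -1) :
    |(derivative^[n] p).eval (a / 2 + s * (a / 2) * y)| * (a / 2) ^ n ≤
      M * (derivative^[n] (Chebyshev.T ℝ D)).eval y := by
  -- The sign `t` recovers the absolute value. The affine map with slope `s * (a / 2)` carries `[-1,
  -- 1]` onto `[0, a]`; `s` decides whether `y ≥ 1` lands beyond `a` or below `0`.
  have key : ∀ t : ℝ, |t| = 1 →
      t * (derivative^[n] p).eval (a / 2 + s * (a / 2) * y) * (s * (a / 2)) ^ n ≤
      M * (derivative^[n] (Chebyshev.T ℝ D)).eval y := by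
    intro t ht
    have h := Chebyshev.eval_iterate_derivative_le_of_forall_abs_le_one (n := D) (k := n)
      (P := C (t / M) * p.comp (C (a / 2) + C (s * (a / 2)) * X)) hy
      (degree_le_of_natDegree_le
        ((natDegree_C_mul_le _ _).trans ((natDegree_comp_linear_le _ _ _).trans hD))) ?_
    · rw [iterate_derivative_C_mul, iterate_derivative_comp_linear] at h
      simp only [eval_mul, eval_C, eval_comp, eval_add, eval_X] at h
      have := mul_le_mul_of_nonneg_left h hM.le
      refine le_trans (le_of_eq ?_) this
      field_simp
    · intro x hx
      simp only [eval_mul, eval_C, eval_comp, eval_add, eval_X, abs_mul, abs_div, ht,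
        abs_of_pos hM]
      rw [div_mul_eq_mul_div, one_mul, div_le_one hM]
      apply hp
      rcases hs with rfl | rfl <;> constructor <;> nlinarith [hx.1, hx.2]
  have h1 := key 1 (by simp)
  have h2 := key (-1) (by simp)
  have h3 : |(derivative^[n] p).eval (a / 2 + s * (a / 2) * y)| * (a / 2) ^ n =
      |(derivative^[n] p).eval (a / 2 + s * (a / 2) * y) * (s * (a / 2)) ^ n| := by
    rw [abs_mul, abs_pow, abs_mul, abs_of_pos (half_pos ha)]
    rcases hs with rfl | rfl <;> simp
  rw [h3, abs_le']
  constructor <;> linarith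

/-- The derivative at `1` is `∏ (D² - l²) / (2l + 1)` over `l < n`, and `(2n)!` is the product of
these odd denominators with `2^n n!`. For `n > D` the factor `l = D` vanishes. -/
lemma iterate_derivative_T_eval_one_le (D n : ℕ) :
    (derivative^[n] (Chebyshev.T ℝ D)).eval 1 * (2 * n).factorial ≤
      (D : ℝ) ^ (2 * n) * (2 ^ n * n.factorial) := by
  have hf : ((2 * n).factorial : ℝ) =
      (∏ l ∈ Finset.range n, (2 * (l : ℝ) + 1)) * (2 ^ n * n.factorial) := by
    induction n with
    | zero => simp
    | succ n ih =>
      rw [show 2 * (n + 1) = 2 * n + 1 + 1 by ring, Nat.factorial_succ, Nat.factorial_succ,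
        Nat.factorial_succ n, Finset.prod_range_succ]
      push_cast
      rw [ih]
      ring
  have h := Chebyshev.iterate_derivative_T_eval_one (R := ℝ) (D : ℤ) n
  push_cast at h
  rw [hf, ← mul_assoc, mul_comm (eval _ _), h]
  gcongr
  by_cases hn : n ≤ D
  · rw [pow_mul]
    refine (Finset.prod_le_prod (g := fun _ => (D : ℝ) ^ 2) ?_ ?_).trans (by simp)
    · intro l hl
      have : (l : ℝ) ≤ D := by exact_mod_cast ((Finset.mem_range.1 hl).trans_le hn).le
      exact sub_nonneg.2 (by gcongr)
    · intro l _
      exact sub_le_self _ (by positivity)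
  · rw [Finset.prod_eq_zero (i := D) (by simp; omega) (by simp)]
    positivity

/-- A polynomial of degree at most `D` bounded by `M` on `[0, 1]` has its `n`-th coefficient
bounded by `M (2D)^{2n} / (2n)!`. -/
lemma abs_coeff_mul_factorial_le {p : ℝ[X]} {D : ℕ} (hD : p.natDegree ≤ D) {M : ℝ} (hM : 0 < M)
    (hp : ∀ x ∈ Set.Icc (0 : ℝ) 1, |p.eval x| ≤ M) (n : ℕ) :
    |p.coeff n| * (2 * n).factorial ≤ M * (2 * D) ^ (2 * n) := by
  have h := abs_iterate_derivative_le hD hM one_pos hp n (-1) le_rfl (Or.inr rfl)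
  have h0 : (derivative^[n] p).eval 0 = n.factorial * p.coeff n := by
    rw [← coeff_zero_eq_eval_zero, coeff_iterate_derivative]
    simp [Nat.descFactorial_self]
  rw [show (1 : ℝ) / 2 + -1 * (1 / 2) * 1 = 0 by norm_num, h0, abs_mul, Nat.abs_cast] at h
  have h2 := iterate_derivative_T_eval_one_le D n
  have hn : (0 : ℝ) < n.factorial := by positivity
  have hnn : (0 : ℝ) < (2 * n).factorial := by positivity
  have e1 : ((1 : ℝ) / 2) ^ n * 2 ^ n = 1 := by rw [← mul_pow]; norm_num
  have h3 : (n.factorial * |p.coeff n| * (1 / 2) ^ n) * (2 * n).factorial ≤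
      M * ((D : ℝ) ^ (2 * n) * (2 ^ n * n.factorial)) := by
    calc _ ≤ (M * (derivative^[n] (Chebyshev.T ℝ D)).eval 1) * (2 * n).factorial := by gcongr
      _ ≤ _ := by rw [mul_assoc]; gcongr
  have h4 : (|p.coeff n| * (2 * n).factorial) * (n.factorial * (1 / 2) ^ n) ≤
      (M * (2 * D) ^ (2 * n)) * (n.factorial * (1 / 2) ^ n) := by
    calc _ = (n.factorial * |p.coeff n| * (1 / 2) ^ n) * (2 * n).factorial := by ring
      _ ≤ _ := h3
      _ = (M * ((D : ℝ) ^ (2 * n) * (2 ^ n * n.factorial))) * ((1 / 2) ^ n * 2 ^ n) := by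
        rw [e1, mul_one]
      _ = _ := by rw [mul_pow, pow_mul 2, show (2 : ℝ) ^ 2 = 2 * 2 by norm_num, mul_pow]; ring
  exact le_of_mul_le_mul_right h4 (by positivity)

/-- Growth of a polynomial of degree at most `m` outside an interval on which it is bounded. -/
lemma abs_eval_le_of_abs_le {p : ℝ[X]} {m : ℕ} (hm : p.natDegree ≤ m) {ε a b : ℝ} (hε : 0 < ε)
    (ha : 0 < a) (hab : a ≤ b) (hp : ∀ x ∈ Set.Icc 0 a, |p.eval x| ≤ ε) :
    |p.eval b| ≤ ε * (4 * b / a) ^ m := by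
  have hy : 1 ≤ 2 * b / a - 1 := by
    have : 1 ≤ b / a := (one_le_div ha).2 hab
    rw [mul_div_assoc]; linarith
  have h := abs_iterate_derivative_le hm hε ha hp 0 1 hy (Or.inl rfl)
  have hb : a / 2 + 1 * (a / 2) * (2 * b / a - 1) = b := by field_simp; ring
  simp only [Function.iterate_zero, id, pow_zero, mul_one, hb] at h
  refine h.trans ?_
  gcongr
  -- With `y = cosh θ`: `T_m(y) = cosh(mθ) ≤ e^(mθ) ≤ (2 cosh θ)^m`.
  have hT : ∀ y : ℝ, 1 ≤ y → (Chebyshev.T ℝ m).eval y ≤ (2 * y) ^ m := by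
    intro y hy
    rw [← Real.cosh_arcosh hy, Chebyshev.T_real_cosh]
    set θ := Real.arcosh y
    have hθ : 0 ≤ θ := Real.arcosh_nonneg hy
    have h1 : Real.exp θ ≤ 2 * Real.cosh θ := by
      rw [Real.cosh_eq]; have := Real.exp_pos (-θ); linarith
    calc Real.cosh ((m : ℤ) * θ) ≤ Real.exp (m * θ) := by
          rw [Real.cosh_eq]
          push_cast
          have : Real.exp (-(m * θ)) ≤ Real.exp (m * θ) :=
            Real.exp_le_exp.2 (by have : 0 ≤ m * θ := by positivity
                                  linarith)
          linarith
      _ = Real.exp θ ^ m := by rw [Real.exp_nat_mul]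
      _ ≤ _ := by gcongr
  refine (hT _ hy).trans ?_
  have : 2 * (2 * b / a - 1) ≤ 4 * b / a := by
    rw [show 4 * b / a = 2 * (2 * b / a) by ring]; linarith
  have h0 : 0 ≤ 2 * (2 * b / a - 1) := by linarith
  gcongr

/-- One term of the exponential series at `2n`, with `e ≤ 3`. It turns the coefficient bound into
`|p.coeff n| * b^n ≤ M (9D²b/n²)^n`, the source of the `9` in the degree condition below. -/
lemma pow_two_mul_le_factorial (n : ℕ) : (2 * n : ℝ) ^ (2 * n) ≤ 9 ^ n * (2 * n).factorial := by
  have h := Real.pow_div_factorial_le_exp (2 * n : ℝ) (by positivity) (2 * n)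
  rw [div_le_iff₀ (by positivity)] at h
  refine h.trans ?_
  gcongr
  have h3 : Real.exp 1 ≤ 3 := Real.exp_one_lt_d9.le.trans (by norm_num)
  calc Real.exp (2 * n) = Real.exp 1 ^ (2 * n) := by
        rw [← Real.exp_nat_mul]; push_cast; rw [mul_one]
    _ ≤ 3 ^ (2 * n) := by gcongr
    _ = 9 ^ n := by rw [pow_mul]; norm_num

/-- A polynomial bounded by `M` on `[0, 1]` and by `η` on `[0, a]` whose degree is small compared
to `(m + 1) / √b` can grow on `[a, b]` only as much as a polynomial of degree `m`. -/
lemma abs_eval_le_of_degree_le {p : ℝ[X]} {D m : ℕ} (hD : p.natDegree ≤ D)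
    {M η γ a b : ℝ} (hM : 0 < M) (hη : 0 < η) (hγ0 : 0 ≤ γ) (hγ : γ ≤ 1 / 2)
    (ha : 0 < a) (hab : a ≤ b)
    (hp : ∀ x ∈ Set.Icc (0 : ℝ) 1, |p.eval x| ≤ M) (hpa : ∀ x ∈ Set.Icc 0 a, |p.eval x| ≤ η)
    (hDb : 9 * (D : ℝ) ^ 2 * b ≤ γ * (m + 1) ^ 2) :
    |p.eval b| ≤ (η + 2 * M * γ ^ (m + 1)) * (4 * b / a) ^ m + 2 * M * γ ^ (m + 1) := by
  have hb : 0 < b := ha.trans_le hab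
  set P : ℝ[X] := ∑ i ∈ Finset.range (m + 1), C (p.coeff i) * X ^ i with hP
  have hPdeg : P.natDegree ≤ m :=
    natDegree_sum_le_of_forall_le _ _ fun i hi =>
      (natDegree_C_mul_X_pow_le _ _).trans (by simpa [Nat.lt_succ_iff] using hi)
  have hcoeff : ∀ n, m + 1 ≤ n → |p.coeff n| * b ^ n ≤ M * γ ^ n := by
    intro n hn
    have hn0 : (0 : ℝ) < n := by exact_mod_cast (Nat.succ_pos m).trans_le hn
    have h1 := abs_coeff_mul_factorial_le hD hM hp n
    have h2 := pow_two_mul_le_factorial n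
    have h3 : 9 * (D : ℝ) ^ 2 * b ≤ γ * n ^ 2 := by
      refine hDb.trans ?_
      have : ((m : ℝ) + 1) ≤ n := by exact_mod_cast hn
      gcongr
    have h4 : |p.coeff n| * (2 * n : ℝ) ^ (2 * n) ≤ 9 ^ n * (M * (2 * D) ^ (2 * n)) := by
      calc _ ≤ |p.coeff n| * (9 ^ n * (2 * n).factorial) := by gcongr
        _ = 9 ^ n * (|p.coeff n| * (2 * n).factorial) := by ring
        _ ≤ _ := by gcongr
    have h5 : (|p.coeff n| * b ^ n) * ((2 * n : ℝ) ^ 2) ^ n ≤ (M * γ ^ n) * ((2 * n : ℝ) ^ 2) ^ n := by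
      calc _ = (|p.coeff n| * (2 * n : ℝ) ^ (2 * n)) * b ^ n := by rw [pow_mul]; ring
        _ ≤ 9 ^ n * (M * (2 * D) ^ (2 * n)) * b ^ n := by gcongr
        _ = M * (4 * (9 * (D : ℝ) ^ 2 * b)) ^ n := by
          rw [pow_mul, show 4 * (9 * (D : ℝ) ^ 2 * b) = 9 * (2 * D) ^ 2 * b by ring, mul_pow _ b,
            mul_pow 9]
          ring
        _ ≤ M * (4 * (γ * n ^ 2)) ^ n := by gcongr
        _ = _ := by rw [show 4 * (γ * (n : ℝ) ^ 2) = γ * (2 * n) ^ 2 by ring, mul_pow γ]; ring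
    exact le_of_mul_le_mul_right h5 (by positivity)
  have htail : ∀ x ∈ Set.Icc 0 b, |p.eval x - P.eval x| ≤ 2 * M * γ ^ (m + 1) := by
    intro x hx
    -- Padding the range past the degree makes the tail a sum over `D + 1` terms, whether or not `m
    -- < D`. It is dominated by a geometric series since `γ ≤ 1/2`.
    rw [eval_eq_sum_range' (n := m + 1 + (D + 1)) (by omega), Finset.sum_range_add, hP,
      eval_finsetSum]
    simp only [eval_mul, eval_C, eval_pow, eval_X, add_sub_cancel_left]
    calc _ ≤ ∑ j ∈ Finset.range (D + 1), |p.coeff (m + 1 + j) * x ^ (m + 1 + j)| :=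
          Finset.abs_sum_le_sum_abs _ _
      _ ≤ ∑ j ∈ Finset.range (D + 1), M * γ ^ (m + 1) * (1 / 2) ^ j := by
          refine Finset.sum_le_sum fun j _ => ?_
          rw [abs_mul, abs_pow, abs_of_nonneg hx.1]
          have hx0 := hx.1
          have hxb := hx.2
          calc _ ≤ |p.coeff (m + 1 + j)| * b ^ (m + 1 + j) := by gcongr
            _ ≤ M * γ ^ (m + 1 + j) := hcoeff _ (by omega)
            _ = M * γ ^ (m + 1) * γ ^ j := by rw [pow_add]; ring
            _ ≤ _ := by gcongr
      _ = M * γ ^ (m + 1) * ∑ j ∈ Finset.range (D + 1), (1 / 2 : ℝ) ^ j := by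
          rw [Finset.mul_sum]
      _ ≤ M * γ ^ (m + 1) * 2 := by gcongr; exact sum_geometric_two_le _
      _ = _ := by ring
  have hPa : ∀ x ∈ Set.Icc 0 a, |P.eval x| ≤ η + 2 * M * γ ^ (m + 1) := by
    intro x hx
    have h1 := abs_le.1 (htail x ⟨hx.1, hx.2.trans hab⟩)
    have h2 := abs_le.1 (hpa x hx)
    rw [abs_le]; constructor <;> linarith [h1.1, h1.2, h2.1, h2.2]
  have h1 := abs_le.1 (abs_eval_le_of_abs_le hPdeg (by positivity) ha hab hPa)
  have h2 := abs_le.1 (htail b ⟨hb.le, le_rfl⟩)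
  rw [abs_le]; constructor <;> linarith [h1.1, h1.2, h2.1, h2.2]

/-! ### Low-degree functions of a subset. -/

section LowDegree
variable {ι : Type*} [DecidableEq ι]

/-- Functions of a set `S` that are linear combinations of the monomials `[I ⊆ S]`, `#I ≤ D`. -/
def lowDegree (ι : Type*) [DecidableEq ι] (D : ℕ) : Submodule ℂ (Finset ι → ℂ) :=
  Submodule.span ℂ {f | ∃ I : Finset ι, I.card ≤ D ∧ f = fun S => if I ⊆ S then 1 else 0}

lemma lowDegree_mono {D E : ℕ} (h : D ≤ E) : lowDegree ι D ≤ lowDegree ι E :=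
  Submodule.span_mono fun _ ⟨I, hI, hf⟩ => ⟨I, hI.trans h, hf⟩

lemma const_mem_lowDegree (D : ℕ) (c : ℂ) : (fun _ => c) ∈ lowDegree ι D := by
  have : (fun _ : Finset ι => c) = c • (fun S => if (∅ : Finset ι) ⊆ S then (1 : ℂ) else 0) := by
    ext; simp
  rw [this]
  exact Submodule.smul_mem _ _ (Submodule.subset_span ⟨∅, by simp, rfl⟩)

/-- Monomials multiply by union of their index sets, so degrees add. -/
lemma mul_mem_lowDegree {D E : ℕ} {f g : Finset ι → ℂ} (hf : f ∈ lowDegree ι D)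
    (hg : g ∈ lowDegree ι E) : (fun S => f S * g S) ∈ lowDegree ι (D + E) := by
  change f * g ∈ _
  have := Submodule.mul_mem_mul hf hg
  rw [lowDegree, lowDegree, Submodule.span_mul_span] at this
  refine Submodule.span_mono ?_ this
  rintro _ ⟨_, ⟨I, hI, rfl⟩, _, ⟨J, hJ, rfl⟩, rfl⟩
  refine ⟨I ∪ J, (Finset.card_union_le _ _).trans (add_le_add hI hJ), ?_⟩
  ext S
  by_cases h1 : I ⊆ S <;> by_cases h2 : J ⊆ S <;> simp [h1, h2, Finset.union_subset_iff]

lemma conj_mem_lowDegree {D : ℕ} {f : Finset ι → ℂ} (hf : f ∈ lowDegree ι D) :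
    (fun S => star (f S)) ∈ lowDegree ι D := by
  induction hf using Submodule.span_induction with
  | mem f h =>
    obtain ⟨I, hI, rfl⟩ := h
    refine Submodule.subset_span ⟨I, hI, ?_⟩
    ext S
    by_cases h : I ⊆ S <;> simp [h]
  | zero => simpa using const_mem_lowDegree (ι := ι) D 0
  | add f g _ _ hf hg => simpa using! add_mem hf hg
  | smul c f _ hf => simpa using! Submodule.smul_mem _ (star c) hf

lemma sum_mem_lowDegree {κ : Type*} {D : ℕ} (s : Finset κ) {f : κ → Finset ι → ℂ}
    (hf : ∀ i ∈ s, f i ∈ lowDegree ι D) : (fun S => ∑ i ∈ s, f i S) ∈ lowDegree ι D := by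
  have : (fun S => ∑ i ∈ s, f i S) = ∑ i ∈ s, f i := by ext; simp
  rw [this]
  exact sum_mem hf

end LowDegree

/-! ### Random subsets: averages and tail bounds. -/

section Bernoulli
variable {ι : Type*} [Fintype ι]

/-- The weight of the set `S` when every element is included independently with probability `p`. -/
def bernoulliWeight (p : ℝ) (S : Finset ι) : ℝ := p ^ S.card * (1 - p) ^ (Fintype.card ι - S.card)

lemma bernoulliWeight_nonneg {p : ℝ} (h0 : 0 ≤ p) (h1 : p ≤ 1) (S : Finset ι) :
    0 ≤ bernoulliWeight p S := by
  have : 0 ≤ 1 - p := by linarith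
  unfold bernoulliWeight
  positivity

/-- The generating function of the size of `S`; both Chernoff bounds use it, at `t = 1/δ` and `t =
1/2`. -/
lemma sum_bernoulliWeight_mul_pow (p t : ℝ) :
    ∑ S : Finset ι, bernoulliWeight p S * t ^ S.card = (1 + p * (t - 1)) ^ Fintype.card ι := by
  rw [show 1 + p * (t - 1) = p * t + (1 - p) by ring, ← Fintype.sum_pow_mul_eq_add_pow]
  refine Finset.sum_congr rfl fun S _ => ?_
  rw [bernoulliWeight, mul_pow]
  ring

lemma sum_bernoulliWeight (p : ℝ) : ∑ S : Finset ι, bernoulliWeight p S = 1 := by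
  simpa using sum_bernoulliWeight_mul_pow (ι := ι) p 1

lemma sum_bernoulliWeight_subset [DecidableEq ι] (p : ℝ) (I : Finset ι) :
    ∑ S : Finset ι, bernoulliWeight p S * (if I ⊆ S then 1 else 0) = p ^ I.card := by
  have h := Finset.prod_add (fun _ : ι => p) (fun i => if i ∈ I then 0 else 1 - p) Finset.univ
  have hl : ∏ i : ι, (p + if i ∈ I then 0 else 1 - p) = p ^ I.card := by
    have : ∀ i : ι, (p + if i ∈ I then 0 else 1 - p) = if i ∈ I then p else 1 := by
      intro i; split_ifs <;> ring
    simp_rw [this]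
    rw [Finset.prod_ite]
    simp
  rw [hl, Finset.powerset_univ] at h
  rw [h]
  refine Finset.sum_congr rfl fun S _ => ?_
  rw [bernoulliWeight, Finset.prod_const]
  by_cases hIS : I ⊆ S
  · rw [if_pos hIS, mul_one]
    congr 1
    rw [Finset.prod_congr rfl (g := fun _ => 1 - p)]
    · rw [Finset.prod_const, ← Finset.compl_eq_univ_sdiff, Finset.card_compl]
    · intro i hi
      rw [if_neg fun h => (Finset.mem_sdiff.1 hi).2 (hIS h)]
  · obtain ⟨i, hi, hiS⟩ := Finset.not_subset.1 hIS
    rw [if_neg hIS, Finset.prod_eq_zero (i := i) (by simp [hiS]) (by simp [hi])]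
    simp

/-- The expectation of a low-degree function under the product distribution is a low-degree
polynomial in the parameter. -/
lemma exists_polynomial_complex [DecidableEq ι] {D : ℕ} {f : Finset ι → ℂ} (hf : f ∈ lowDegree ι D) :
    ∃ P : ℂ[X], P.natDegree ≤ D ∧
      ∀ p : ℝ, P.eval (p : ℂ) = ∑ S : Finset ι, (bernoulliWeight p S : ℂ) * f S := by
  induction hf using Submodule.span_induction with
  | mem f h =>
    obtain ⟨I, hI, rfl⟩ := h
    refine ⟨X ^ I.card, by simpa using hI, fun p => ?_⟩
    rw [eval_pow, eval_X, ← Complex.ofReal_pow, ← sum_bernoulliWeight_subset]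
    push_cast
    refine Finset.sum_congr rfl fun S _ => ?_
    split_ifs <;> simp
  | zero => exact ⟨0, by simp, by simp⟩
  | add f g _ _ hf hg =>
    obtain ⟨P, hP, hP'⟩ := hf
    obtain ⟨Q, hQ, hQ'⟩ := hg
    refine ⟨P + Q, natDegree_add_le_of_degree_le hP hQ, fun p => ?_⟩
    rw [eval_add, hP', hQ', ← Finset.sum_add_distrib]
    simp [mul_add]
  | smul c f _ hf =>
    obtain ⟨P, hP, hP'⟩ := hf
    refine ⟨C c * P, (natDegree_C_mul_le _ _).trans hP, fun p => ?_⟩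
    rw [eval_mul, eval_C, hP', Finset.mul_sum]
    refine Finset.sum_congr rfl fun S _ => ?_
    rw [Pi.smul_apply, smul_eq_mul]
    ring

/-- At real `p` the average is real, so taking real parts of the coefficients does not change it. -/
lemma exists_polynomial_real [DecidableEq ι] {D : ℕ} {F : Finset ι → ℝ}
    (hF : (fun S => (F S : ℂ)) ∈ lowDegree ι D) :
    ∃ P : ℝ[X], P.natDegree ≤ D ∧
      ∀ p : ℝ, P.eval p = ∑ S : Finset ι, bernoulliWeight p S * F S := by
  obtain ⟨P, hP, hP'⟩ := exists_polynomial_complex hF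
  refine ⟨∑ i ∈ Finset.range (D + 1), C (P.coeff i).re * X ^ i,
    natDegree_sum_le_of_forall_le _ _ fun i hi =>
      (natDegree_C_mul_X_pow_le _ _).trans (by simpa [Nat.lt_succ_iff] using hi), fun p => ?_⟩
  have h := congrArg Complex.re (hP' p)
  rw [eval_eq_sum_range' (n := D + 1) (by omega), Complex.re_sum, Complex.re_sum] at h
  simp only [eval_finsetSum, eval_mul, eval_C, eval_pow, eval_X]
  simpa [← Complex.ofReal_pow, ← Complex.ofReal_mul] using! h

/-- Chernoff bound for the upper tail. -/
lemma sum_bernoulliWeight_card_gt_le {p δ : ℝ} {w : ℕ} (hp0 : 0 ≤ p) (hp1 : p ≤ 1) (hδ : 0 < δ)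
    (hδ1 : δ ≤ 1) (hp : p * Fintype.card ι ≤ δ * w) :
    ∑ S : Finset ι, bernoulliWeight p S * (if w < S.card then 1 else 0) ≤
      (Real.exp 1 * δ) ^ w := by
  have h1 : ∀ S : Finset ι, bernoulliWeight p S * (if w < S.card then 1 else 0) ≤
      bernoulliWeight p S * (1 / δ) ^ S.card * δ ^ w := by
    intro S
    rw [mul_assoc]
    refine mul_le_mul_of_nonneg_left ?_ (bernoulliWeight_nonneg hp0 hp1 S)
    split_ifs with h
    · obtain ⟨j, hj⟩ := Nat.exists_eq_add_of_lt h
      rw [hj, add_assoc, pow_add, mul_right_comm, ← mul_pow, one_div, inv_mul_cancel₀ hδ.ne',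
        one_pow, one_mul]
      exact one_le_pow₀ ((one_le_inv₀ hδ).2 hδ1)
    · positivity
  refine (Finset.sum_le_sum fun S _ => h1 S).trans ?_
  rw [← Finset.sum_mul, sum_bernoulliWeight_mul_pow, mul_pow]
  gcongr
  have h2 : 1 + p * (1 / δ - 1) ≤ Real.exp (p / δ) := by
    have := Real.add_one_le_exp (p / δ)
    have : p * (1 / δ - 1) = p / δ - p := by ring
    linarith
  have h0 : 0 ≤ 1 / δ - 1 := by rw [sub_nonneg, one_div]; exact (one_le_inv₀ hδ).2 hδ1
  calc _ ≤ Real.exp (p / δ) ^ Fintype.card ι := by gcongr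
    _ = Real.exp (Fintype.card ι * (p / δ)) := by rw [Real.exp_nat_mul]
    _ ≤ Real.exp (w * 1) := by
      apply Real.exp_le_exp.2
      rw [mul_one, mul_div_assoc', div_le_iff₀ hδ]
      linarith
    _ = _ := Real.exp_nat_mul _ _

/-- Chernoff bound for the lower tail. -/
lemma sum_bernoulliWeight_card_lt_le {p : ℝ} {w : ℕ} (hp0 : 0 ≤ p) (hp1 : p ≤ 1)
    (hw : 1 ≤ w) (hp : 8 * w ≤ p * Fintype.card ι) :
    ∑ S : Finset ι, bernoulliWeight p S * (if S.card < 2 * w then 1 else 0) ≤ 1 / 2 := by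
  have h1 : ∀ S : Finset ι, bernoulliWeight p S * (if S.card < 2 * w then 1 else 0) ≤
      bernoulliWeight p S * (1 / 2) ^ S.card * 2 ^ (2 * w) := by
    intro S
    rw [mul_assoc]
    refine mul_le_mul_of_nonneg_left ?_ (bernoulliWeight_nonneg hp0 hp1 S)
    split_ifs with h
    · obtain ⟨j, hj⟩ := Nat.exists_eq_add_of_lt h
      rw [hj, add_assoc, pow_add, ← mul_assoc, ← mul_pow]
      norm_num
      exact one_le_pow₀ (by norm_num)
    · positivity
  refine (Finset.sum_le_sum fun S _ => h1 S).trans ?_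
  rw [← Finset.sum_mul, sum_bernoulliWeight_mul_pow]
  have h2 : 1 + p * (1 / 2 - 1) ≤ Real.exp (-(p / 2)) := by
    have := Real.add_one_le_exp (-(p / 2))
    linarith
  have h3 : (1 + p * (1 / 2 - 1)) ^ Fintype.card ι ≤ Real.exp (-4) ^ w := by
    calc _ ≤ Real.exp (-(p / 2)) ^ Fintype.card ι := by
          have : 0 ≤ 1 + p * (1 / 2 - 1) := by linarith
          gcongr
      _ = Real.exp (Fintype.card ι * -(p / 2)) := by rw [Real.exp_nat_mul]
      _ ≤ Real.exp (w * -4) := by apply Real.exp_le_exp.2; linarith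
      _ = _ := Real.exp_nat_mul _ _
  have h4 : Real.exp (-4) ≤ 1 / 8 := by
    have h := Real.exp_one_gt_d9
    have h5 : (8 : ℝ) ≤ Real.exp 4 := by
      have : Real.exp 4 = Real.exp 1 ^ 4 := by rw [← Real.exp_nat_mul]; norm_num
      rw [this]
      calc (8 : ℝ) ≤ 2 ^ 4 := by norm_num
        _ ≤ _ := by gcongr; linarith
    rw [Real.exp_neg, ← one_div]
    exact one_div_le_one_div_of_le (by norm_num) h5
  calc _ ≤ Real.exp (-4) ^ w * 2 ^ (2 * w) := by gcongr
    _ ≤ (1 / 8) ^ w * 2 ^ (2 * w) := by gcongr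
    _ = (1 / 2) ^ w := by rw [pow_mul, ← mul_pow]; norm_num
    _ ≤ (1 / 2) ^ 1 := pow_le_pow_of_le_one (by norm_num) (by norm_num) hw
    _ = _ := by norm_num

end Bernoulli

open Matrix

/-! ### Hermitian matrices: traces and quadratic forms. -/

section Spectral
variable {n : Type*} [Fintype n]

lemma sum_norm_sq_eq_dotProduct (φ : n → ℂ) :
    ((∑ x, ‖φ x‖ ^ 2 : ℝ) : ℂ) = star φ ⬝ᵥ φ := by
  rw [dotProduct]
  push_cast
  refine Finset.sum_congr rfl fun x _ => ?_
  rw [Pi.star_apply, ← Complex.conj_mul']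
  rfl

variable [DecidableEq n]

lemma sum_norm_sq_mulVec (V : Matrix.unitaryGroup n ℂ) (φ : n → ℂ) :
    ∑ x, ‖((V : Matrix n n ℂ) *ᵥ φ) x‖ ^ 2 = ∑ x, ‖φ x‖ ^ 2 := by
  have h : ((∑ x, ‖((V : Matrix n n ℂ) *ᵥ φ) x‖ ^ 2 : ℝ) : ℂ) = ((∑ x, ‖φ x‖ ^ 2 : ℝ) : ℂ) := by
    rw [sum_norm_sq_eq_dotProduct, sum_norm_sq_eq_dotProduct, star_mulVec, dotProduct_mulVec,
      vecMul_vecMul, ← star_eq_conjTranspose, Unitary.coe_star_mul_self, vecMul_one]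
  exact_mod_cast h

/-- Diagonalisation commutes with `aeval` and the trace is conjugation invariant. Thus a sum over
the spectrum is polynomial in the matrix entries. -/
lemma trace_aeval_eq_sum_eigenvalues {M : Matrix n n ℂ} (hM : M.IsHermitian) (f : ℝ[X]) :
    (aeval M f).trace = ∑ i, ((f.eval (hM.eigenvalues i) : ℝ) : ℂ) := by
  set V := hM.eigenvectorUnitary
  have h1 : aeval M f =
      Unitary.conjStarAlgAut ℂ _ V (diagonal fun i => ((f.eval (hM.eigenvalues i) : ℝ) : ℂ)) := by
    have h2 : diagonal (fun i => ((f.eval (hM.eigenvalues i) : ℝ) : ℂ)) =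
        aeval (diagonal (RCLike.ofReal ∘ hM.eigenvalues) : Matrix n n ℂ) f := by
      have h3 := aeval_algHom_apply (diagonalAlgHom (n := n) (α := ℂ) ℝ)
        (RCLike.ofReal ∘ hM.eigenvalues) f
      simp only [diagonalAlgHom_apply] at h3
      rw [h3]
      congr 1
      ext i
      rw [← Pi.evalAlgHom_apply ℝ (fun _ : n => ℂ) i (aeval _ f), ← aeval_algHom_apply]
      exact (aeval_algebraMap_apply ℂ (hM.eigenvalues i) f).symm
    rw [h2]
    have h4 := aeval_algHom_apply
      ((Unitary.conjStarAlgAut ℂ _ V).toAlgEquiv.toAlgHom.restrictScalars ℝ)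
      (diagonal (RCLike.ofReal ∘ hM.eigenvalues) : Matrix n n ℂ) f
    refine Eq.trans ?_ h4
    exact congrArg (fun N => aeval N f) hM.spectral_theorem
  rw [h1, Unitary.conjStarAlgAut_apply, trace_mul_cycle, Unitary.coe_star_mul_self, one_mul,
    trace_diagonal]

/-- If all eigenvalues are at most `a`, so is the quadratic form on states. -/
lemma re_dotProduct_mulVec_lt {M : Matrix n n ℂ} (hM : M.IsHermitian) {a : ℝ}
    (ha : ∀ i, hM.eigenvalues i < a) {ψ : n → ℂ} (hψ : IsState ψ) :
    (star ψ ⬝ᵥ M *ᵥ ψ).re < a := by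
  set V := hM.eigenvectorUnitary
  set c : n → ℂ := (star (V : Matrix n n ℂ)) *ᵥ ψ with hc
  have hcn : ∑ i, ‖c i‖ ^ 2 = 1 := by
    have := sum_norm_sq_mulVec (star V) ψ
    rw [Unitary.coe_star] at this
    rw [hc, this]
    exact hψ
  have h1 : star ψ ⬝ᵥ M *ᵥ ψ = ((∑ i, hM.eigenvalues i * ‖c i‖ ^ 2 : ℝ) : ℂ) := by
    have hM' : M = (V : Matrix n n ℂ) * diagonal (RCLike.ofReal ∘ hM.eigenvalues) *
        star (V : Matrix n n ℂ) := by
      conv_lhs => rw [hM.spectral_theorem, Unitary.conjStarAlgAut_apply]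
    have h2 : star c = star ψ ᵥ* (V : Matrix n n ℂ) := by
      rw [hc, star_mulVec, star_eq_conjTranspose, conjTranspose_conjTranspose]
    conv_lhs => rw [hM']
    rw [← mulVec_mulVec, ← mulVec_mulVec, ← hc, dotProduct_mulVec, ← h2, dotProduct]
    push_cast
    refine Finset.sum_congr rfl fun i _ => ?_
    rw [mulVec_diagonal, Pi.star_apply, ← Complex.conj_mul']
    change star (c i) * ((hM.eigenvalues i : ℂ) * _) = _
    rw [← starRingEnd_apply]
    ring
  rw [h1, Complex.ofReal_re]
  have hex : ∃ i ∈ Finset.univ, 0 < ‖c i‖ ^ 2 := by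
    by_contra! h
    have : ∑ i, ‖c i‖ ^ 2 ≤ 0 := Finset.sum_nonpos h
    linarith
  obtain ⟨i, hi, hi'⟩ := hex
  calc _ < ∑ i, a * ‖c i‖ ^ 2 := by
        refine Finset.sum_lt_sum (fun j _ => ?_) ⟨i, hi, ?_⟩
        · exact mul_le_mul_of_nonneg_right (ha j).le (by positivity)
        · exact mul_lt_mul_of_pos_right (ha i) hi'
    _ = a := by rw [← Finset.mul_sum, hcn, mul_one]

lemma exists_isState_eigenvalues_eq {M : Matrix n n ℂ} (hM : M.IsHermitian) (i : n) :
    ∃ ψ : n → ℂ, IsState ψ ∧ hM.eigenvalues i = (star ψ ⬝ᵥ M *ᵥ ψ).re := by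
  refine ⟨hM.eigenvectorBasis i, ?_, hM.eigenvalues_eq i⟩
  have h := hM.eigenvectorBasis.orthonormal.1 i
  rw [EuclideanSpace.norm_eq, Real.sqrt_eq_one] at h
  exact h

end Spectral

/-- A polynomial that amplifies the gap between `1/3` and `2/3`. -/
lemma exists_amplifying_polynomial : ∃ f : ℝ[X],
    (∀ x ∈ Set.Icc (0 : ℝ) 1, f.eval x ∈ Set.Icc (0 : ℝ) 1) ∧
    (∀ x ∈ Set.Icc (0 : ℝ) (1 / 3), f.eval x ≤ 1 / 2 ^ 14) ∧
    (∀ x ∈ Set.Icc (2 / 3 : ℝ) 1, 1 / 2 ≤ f.eval x) := by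
  obtain ⟨N, hN⟩ : ∃ N : ℕ, (N : ℝ) = 4000 := ⟨4000, by norm_num⟩
  -- The constants satisfy `4000 / 3^20 ≤ 2^-14` (union bound below `1/3`) and `4000 (2/3)^20 ≥ 1`
  -- (failure at most `1/e` above `2/3`).
  refine ⟨1 - (1 - X ^ 20) ^ N, ?_, ?_, ?_⟩ <;> intro x hx <;>
    simp only [eval_sub, eval_one, eval_pow, eval_X]
  · have h0 : 0 ≤ x ^ 20 := pow_nonneg hx.1 _
    have h1 : x ^ 20 ≤ 1 := pow_le_one₀ hx.1 hx.2
    have h2 : (1 - x ^ 20) ^ N ≤ 1 := pow_le_one₀ (by linarith) (by linarith)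
    have h3 : 0 ≤ (1 - x ^ 20) ^ N := pow_nonneg (by linarith) _
    constructor <;> linarith
  · have h1 : x ^ 20 ≤ (1 / 3) ^ 20 := pow_le_pow_left₀ hx.1 hx.2 _
    have h2 : ((1 / 3 : ℝ)) ^ 20 ≤ 1 / 4000 / 2 ^ 14 := by norm_num
    have h3 := one_add_mul_le_pow (a := -(x ^ 20)) (by linarith) N
    rw [← sub_eq_add_neg, hN] at h3
    linarith
  · have h1 : (2 / 3) ^ 20 ≤ x ^ 20 := pow_le_pow_left₀ (by norm_num) hx.1 _
    have h2 : (1 : ℝ) / 4000 ≤ (2 / 3) ^ 20 := by norm_num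
    have h3 : (1 - x ^ 20) ^ N ≤ Real.exp (-(x ^ 20)) ^ N := by
      have h4 := Real.add_one_le_exp (-(x ^ 20))
      have h5 : x ^ 20 ≤ 1 := pow_le_one₀ (by linarith [hx.1]) hx.2
      exact pow_le_pow_left₀ (by linarith) (by linarith) _
    have h4 : Real.exp (-(x ^ 20)) ^ N ≤ Real.exp (-1) := by
      rw [← Real.exp_nat_mul, hN]
      apply Real.exp_le_exp.2
      linarith
    have h5 := Real.exp_neg_one_lt_d9
    linarith

/-! ### Sign oracles and the algorithm run on them. -/

section Oracle
variable {d : ℕ}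

/-- The oracle that encodes the coordinate subspace spanned by `S`. -/
def signOracle (S : Finset (Fin d)) : Matrix.unitaryGroup (Fin d) ℂ :=
  ⟨diagonal fun i => if i ∈ S then -1 else 1, by
    rw [mem_unitaryGroup_iff, star_eq_conjTranspose, diagonal_conjTranspose, diagonal_mul_diagonal,
      ← diagonal_one]
    congr 1
    ext i
    by_cases h : i ∈ S <;> simp [h]⟩

lemma signOracle_inv (S : Finset (Fin d)) : (signOracle S)⁻¹ = signOracle S := by
  apply Subtype.ext
  change star (diagonal _) = diagonal _
  rw [star_eq_conjTranspose, diagonal_conjTranspose]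
  congr 1
  ext i
  by_cases h : i ∈ S <;> simp [h]

lemma exists_encodes_signOracle (S : Finset (Fin d)) :
    ∃ K : Submodule ℂ (EuclideanSpace ℂ (Fin d)), Encodes (signOracle S) K ∧
      Module.finrank ℂ K = S.card := by
  set b := EuclideanSpace.basisFun (Fin d) ℂ with hb
  set K := Submodule.span ℂ (Set.range fun i : S => b i)
  refine ⟨K, fun v => ?_, ?_⟩
  · have hv : K.starProjection v = ∑ i ∈ S, v i • b i := by
      refine Submodule.eq_starProjection_of_mem_of_inner_eq_zero ?_ ?_
      · exact Submodule.sum_mem _ fun i hi =>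
          Submodule.smul_mem _ _ (Submodule.subset_span ⟨⟨i, hi⟩, rfl⟩)
      · intro u hu
        induction hu using Submodule.span_induction with
        | mem u h =>
          obtain ⟨i, rfl⟩ := h
          have hi : (i : Fin d) ∈ S := i.2
          simp [hb, EuclideanSpace.inner_single_right, Finset.sum_apply, Pi.single_apply, hi]
        | zero => simp
        | add u u' _ _ h h' => rw [inner_add_right, h, h', add_zero]
        | smul c u _ h => rw [inner_smul_right, h, mul_zero]
    rw [hv]
    ext i
    by_cases h : i ∈ S
    · simp [signOracle, hb, mulVec_diagonal, h, Pi.single_apply]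
      ring
    · simp [signOracle, hb, mulVec_diagonal, h, Pi.single_apply]
  · have hli : LinearIndependent ℂ fun i : S => b i :=
      b.toBasis.linearIndependent.comp _ Subtype.val_injective
    rw [finrank_span_eq_card hli]
    simp

end Oracle

namespace Algorithm
variable {d m T : ℕ} (A : Algorithm d m T)

lemma controlled_signOracle {r : ℕ} (S : Finset (Fin d)) (φ : Label d m r → ℂ)
    (x : Label d m r) :
    controlled (signOracle S) φ x = (if x.1 = true ∧ x.2.1 ∈ S then -1 else 1) * φ x := by
  obtain ⟨c, i, k⟩ := x
  cases c
  · simp [controlled]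
  · by_cases h : i ∈ S <;> simp [controlled, signOracle, diagonal_apply, h]

lemma stateAfter_signOracle_succ (S : Finset (Fin d)) (ψ : (Fin m → Bool) → ℂ) (t : ℕ)
    (ht : t + 1 ≤ T) (x : Label d m A.r) :
    A.stateAfter (signOracle S) ψ (t + 1) ht x =
      ((A.gate ⟨t + 1, Nat.lt_succ_of_le ht⟩ : Matrix _ _ ℂ) *ᵥ
        fun y => (if y.1 = true ∧ y.2.1 ∈ S then -1 else 1) *
          A.stateAfter (signOracle S) ψ t (Nat.le_of_succ_le ht) y) x := by
  rw [stateAfter, signOracle_inv, ite_self]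
  congr 2
  ext y
  exact controlled_signOracle S _ y

/-- A query multiplies each amplitude by `1` or by `1 - 2[i ∈ S]`, raising the degree by at most
one; the gates are linear and independent of `S`. -/
lemma stateAfter_mem_lowDegree (ψ : (Fin m → Bool) → ℂ) (t : ℕ) (ht : t ≤ T)
    (x : Label d m A.r) :
    (fun S => A.stateAfter (signOracle S) ψ t ht x) ∈ lowDegree (Fin d) t := by
  induction t generalizing x with
  | zero => exact const_mem_lowDegree _ _
  | succ t ih =>
    simp only [stateAfter_signOracle_succ, mulVec, dotProduct]
    refine sum_mem_lowDegree _ fun y _ => ?_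
    refine lowDegree_mono (show 0 + (1 + t) ≤ t + 1 by omega)
      (mul_mem_lowDegree (const_mem_lowDegree _ _) (mul_mem_lowDegree ?_ (ih _ y)))
    by_cases hy : y.1 = true
    · have : (fun S => if y.1 = true ∧ y.2.1 ∈ S then (-1 : ℂ) else 1) =
          (fun _ => 1) + (-2 : ℂ) • (fun S : Finset (Fin d) => if {y.2.1} ⊆ S then 1 else 0) := by
        ext S
        by_cases h : y.2.1 ∈ S
        · simp [hy, h]; norm_num
        · simp [h]
      rw [this]
      exact add_mem (const_mem_lowDegree _ _)
        (Submodule.smul_mem _ _ (Submodule.subset_span ⟨{y.2.1}, by simp, rfl⟩))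
    · simpa [hy] using const_mem_lowDegree (ι := Fin d) 1 1

/-- Linearity in the proof is what makes acceptance a quadratic form with a matrix depending on `S`
alone. -/
lemma stateAfter_eq_sum (S : Finset (Fin d)) (ψ : (Fin m → Bool) → ℂ) (t : ℕ) (ht : t ≤ T)
    (x : Label d m A.r) :
    A.stateAfter (signOracle S) ψ t ht x =
      ∑ s, A.stateAfter (signOracle S) (Pi.single s 1) t ht x * ψ s := by
  induction t generalizing x with
  | zero =>
    simp only [stateAfter, mulVec, dotProduct, Finset.sum_mul]
    rw [Finset.sum_comm]
    refine Finset.sum_congr rfl fun y _ => ?_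
    simp only [initial, mul_assoc, ← Finset.mul_sum]
    congr 1
    split_ifs <;> simp [Pi.single_apply]
  | succ t ih =>
    simp only [stateAfter_signOracle_succ, mulVec, dotProduct, Finset.sum_mul]
    rw [Finset.sum_comm]
    refine Finset.sum_congr rfl fun y _ => ?_
    rw [ih _ y]
    simp only [Finset.mul_sum, mul_assoc]

lemma sum_norm_sq_stateAfter (S : Finset (Fin d)) {ψ : (Fin m → Bool) → ℂ} (hψ : IsState ψ)
    (t : ℕ) (ht : t ≤ T) : ∑ x, ‖A.stateAfter (signOracle S) ψ t ht x‖ ^ 2 = 1 := by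
  induction t with
  | zero =>
    simp only [stateAfter, sum_norm_sq_mulVec]
    rw [← hψ]
    have : ∀ x : Label d m A.r, ‖A.initial ψ x‖ ^ 2 =
        if x.1 = A.start.1 ∧ x.2.1 = A.start.2.1 ∧ x.2.2.1 = A.start.2.2 then
          ‖ψ x.2.2.2‖ ^ 2 else 0 := by
      intro x
      simp only [initial, Prod.ext_iff]
      split_ifs <;> simp
    simp only [this, Fintype.sum_prod_type, ite_and]
    simp [Finset.sum_ite_irrel]
  | succ t ih =>
    simp only [stateAfter_signOracle_succ, sum_norm_sq_mulVec]
    rw [← ih (Nat.le_of_succ_le ht)]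
    refine Finset.sum_congr rfl fun y _ => ?_
    split_ifs <;> simp

/-- The map from proofs to the accepting part of the final state. -/
def acceptMatrix (S : Finset (Fin d)) : Matrix (Label d m A.r) (Fin m → Bool) ℂ :=
  Matrix.of fun x s =>
    if x ∈ A.accept then A.stateAfter (signOracle S) (Pi.single s 1) T le_rfl x else 0

lemma acceptProb_eq (S : Finset (Fin d)) (ψ : (Fin m → Bool) → ℂ) :
    A.acceptProb (signOracle S) ψ =
      (star ψ ⬝ᵥ ((A.acceptMatrix S)ᴴ * A.acceptMatrix S) *ᵥ ψ).re := by
  have h1 : A.acceptProb (signOracle S) ψ = ∑ x, ‖(A.acceptMatrix S *ᵥ ψ) x‖ ^ 2 := by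
    rw [acceptProb, ← Finset.sum_filter_add_sum_filter_not Finset.univ (· ∈ A.accept)]
    rw [Finset.filter_univ_mem]
    rw [Finset.sum_eq_zero (s := {x | x ∉ A.accept}), add_zero]
    · refine Finset.sum_congr rfl fun x hx => ?_
      rw [stateAfter_eq_sum]
      simp [acceptMatrix, mulVec, dotProduct, hx]
    · intro x hx
      have : x ∉ A.accept := by simpa using hx
      simp [acceptMatrix, mulVec, dotProduct, this]
  rw [← Complex.ofReal_re (A.acceptProb _ _), h1, sum_norm_sq_eq_dotProduct, ← mulVec_mulVec,
    dotProduct_mulVec (star ψ), star_mulVec]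

lemma acceptProb_le_one (S : Finset (Fin d)) {ψ : (Fin m → Bool) → ℂ} (hψ : IsState ψ) :
    A.acceptProb (signOracle S) ψ ≤ 1 := by
  rw [← A.sum_norm_sq_stateAfter S hψ T le_rfl]
  exact Finset.sum_le_univ_sum_of_nonneg fun _ => by positivity

lemma acceptProb_nonneg (U : Matrix.unitaryGroup (Fin d) ℂ) (ψ : (Fin m → Bool) → ℂ) :
    0 ≤ A.acceptProb U ψ :=
  Finset.sum_nonneg fun _ _ => by positivity

lemma acceptMatrix_gram_mem_lowDegree (s s' : Fin m → Bool) :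
    (fun S => ((A.acceptMatrix S)ᴴ * A.acceptMatrix S) s s') ∈ lowDegree (Fin d) (2 * T) := by
  simp only [mul_apply, conjTranspose_apply]
  refine sum_mem_lowDegree _ fun x _ => ?_
  rw [two_mul]
  by_cases hx : x ∈ A.accept
  · simp only [acceptMatrix, of_apply, if_pos hx]
    exact mul_mem_lowDegree (conj_mem_lowDegree (A.stateAfter_mem_lowDegree _ _ _ _))
      (A.stateAfter_mem_lowDegree _ _ _ _)
  · simp only [acceptMatrix, of_apply, if_neg hx, mul_zero]
    exact const_mem_lowDegree _ _

end Algorithm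

/-! ### Amplification and the final estimates. -/

lemma pow_mem_lowDegree {ι n : Type*} [DecidableEq ι] [Fintype n] [DecidableEq n] {D : ℕ}
    {M : Finset ι → Matrix n n ℂ} (hM : ∀ s s', (fun S => M S s s') ∈ lowDegree ι D) (k : ℕ)
    (s s' : n) : (fun S => (M S ^ k) s s') ∈ lowDegree ι (k * D) := by
  induction k generalizing s s' with
  | zero => simpa using const_mem_lowDegree _ _
  | succ k ih =>
    simp only [pow_succ, mul_apply]
    rw [Nat.succ_mul]
    exact sum_mem_lowDegree _ fun y _ => mul_mem_lowDegree (ih _ _) (hM _ _)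

lemma trace_aeval_mem_lowDegree {ι n : Type*} [DecidableEq ι] [Fintype n] [DecidableEq n] {D : ℕ}
    {M : Finset ι → Matrix n n ℂ} (hM : ∀ s s', (fun S => M S s s') ∈ lowDegree ι D) (f : ℝ[X]) :
    (fun S => (aeval (M S) f).trace) ∈ lowDegree ι (f.natDegree * D) := by
  simp only [trace, diag_apply, aeval_eq_sum_range, Matrix.sum_apply, Matrix.smul_apply]
  refine sum_mem_lowDegree _ fun s _ => sum_mem_lowDegree _ fun k hk => ?_
  have h := lowDegree_mono (Nat.mul_le_mul_right D (Nat.lt_succ_iff.1 (Finset.mem_range.1 hk)))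
    (pow_mem_lowDegree hM k s s)
  simpa using! Submodule.smul_mem _ (f.coeff k : ℂ) h

/-- Amplification and guessing of the proof: a tester yields a low-degree function of the
coordinate subspace that is exponentially small on no instances, and much larger on yes
instances. -/
lemma Algorithm.IsQMATester.exists_lowDegree {d w m T : ℕ} {A : Algorithm d m T}
    (hA : A.IsQMATester (approxDimYes d w) (approxDimNo d w)) {f : ℝ[X]} {ε : ℝ}
    (hf : ∀ x ∈ Set.Icc (0 : ℝ) 1, f.eval x ∈ Set.Icc (0 : ℝ) 1)
    (hno : ∀ x ∈ Set.Icc (0 : ℝ) (1 / 3), f.eval x ≤ ε)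
    (hyes : ∀ x ∈ Set.Icc (2 / 3 : ℝ) 1, 1 / 2 ≤ f.eval x) (k : ℕ) :
    ∃ G : Finset (Fin d) → ℝ,
      (fun S => (G S : ℂ)) ∈ lowDegree (Fin d) (k * f.natDegree * (2 * T)) ∧
      (∀ S, 0 ≤ G S) ∧ (∀ S, G S ≤ 2 ^ m) ∧ (∀ S, S.card ≤ w → G S ≤ 2 ^ m * ε ^ k) ∧
      ∀ S, 2 * w ≤ S.card → (1 / 2) ^ k ≤ G S := by
  have hM : ∀ S, ((A.acceptMatrix S)ᴴ * A.acceptMatrix S).IsHermitian := fun S =>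
    isHermitian_conjTranspose_mul_self _
  have hev : ∀ S i, ∃ ψ, IsState ψ ∧
      (hM S).eigenvalues i = A.acceptProb (signOracle S) ψ := by
    intro S i
    obtain ⟨ψ, hψ, h⟩ := exists_isState_eigenvalues_eq (hM S) i
    exact ⟨ψ, hψ, by rw [h, A.acceptProb_eq]⟩
  have hev01 : ∀ S i, (hM S).eigenvalues i ∈ Set.Icc (0 : ℝ) 1 := by
    intro S i
    obtain ⟨ψ, hψ, h⟩ := hev S i
    rw [h]
    exact ⟨A.acceptProb_nonneg _ _, A.acceptProb_le_one S hψ⟩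
  refine ⟨fun S => ∑ i, f.eval ((hM S).eigenvalues i) ^ k, ?_, ?_, ?_, ?_, ?_⟩
  · have h := trace_aeval_mem_lowDegree (A.acceptMatrix_gram_mem_lowDegree) (f ^ k)
    refine lowDegree_mono (Nat.mul_le_mul_right _ natDegree_pow_le) ?_
    refine (congrArg (· ∈ _) ?_).mp h
    ext S
    rw [trace_aeval_eq_sum_eigenvalues (hM S)]
    push_cast
    simp
  · exact fun S => Finset.sum_nonneg fun i _ => pow_nonneg (hf _ (hev01 S i)).1 _
  · intro S
    refine (Finset.sum_le_card_nsmul _ _ 1 fun i _ =>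
      pow_le_one₀ (hf _ (hev01 S i)).1 (hf _ (hev01 S i)).2).trans ?_
    simp
  · intro S hS
    refine (Finset.sum_le_card_nsmul _ _ (ε ^ k) fun i _ =>
      pow_le_pow_left₀ (hf _ (hev01 S i)).1 (hno _ ⟨(hev01 S i).1, ?_⟩) k).trans ?_
    · obtain ⟨ψ, hψ, h⟩ := hev S i
      obtain ⟨K, hK, hKS⟩ := exists_encodes_signOracle S
      rw [h]
      exact hA.2 _ ⟨K, hK, hKS.trans_le hS⟩ ψ hψ
    · simp
  · intro S hS
    obtain ⟨K, hK, hKS⟩ := exists_encodes_signOracle S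
    obtain ⟨ψ, hψ, h⟩ := hA.1 _ ⟨K, hK, hS.trans_eq hKS.symm⟩
    -- Otherwise every state would be accepted with probability below `2/3`. One such eigenvalue
    -- suffices, as all terms of the trace are nonnegative.
    have hex : ∃ i, 2 / 3 ≤ (hM S).eigenvalues i := by
      by_contra! hlt
      have := re_dotProduct_mulVec_lt (hM S) hlt hψ
      rw [← A.acceptProb_eq] at this
      linarith
    obtain ⟨i, hi⟩ := hex
    calc (1 / 2 : ℝ) ^ k ≤ f.eval ((hM S).eigenvalues i) ^ k :=
          pow_le_pow_left₀ (by norm_num) (hyes _ ⟨hi, (hev01 S i).2⟩) k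
      _ ≤ _ := Finset.single_le_sum (f := fun i => f.eval ((hM S).eigenvalues i) ^ k)
          (fun i _ => pow_nonneg (hf _ (hev01 S i)).1 _) (Finset.mem_univ i)

/-- Without queries, yes and no instances cannot be told apart. -/
lemma Algorithm.IsQMATester.queries_ne_zero {d w m T : ℕ} (hwd : 2 * w ≤ d) {A : Algorithm d m T}
    (hA : A.IsQMATester (approxDimYes d w) (approxDimNo d w)) : T ≠ 0 := by
  rintro rfl
  obtain ⟨K, hK, hK'⟩ := exists_encodes_signOracle (Finset.univ : Finset (Fin d))
  obtain ⟨K₀, hK₀, hK₀'⟩ := exists_encodes_signOracle (∅ : Finset (Fin d))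
  obtain ⟨ψ, hψ, h⟩ := hA.1 _ ⟨K, hK, by simpa [hK'] using hwd⟩
  have h' := hA.2 _ ⟨K₀, hK₀, by simp [hK₀']⟩ ψ hψ
  have : A.acceptProb (signOracle Finset.univ) ψ = A.acceptProb (signOracle ∅) ψ := rfl
  linarith

/-- The bounds on the Bernoulli average of a function that separates small from large sets. -/
lemma bernoulli_average_bounds {d w : ℕ} (hw : 1 ≤ w) (hd : 0 < d) {G : Finset (Fin d) → ℝ}
    {M η κ : ℝ} (hG0 : ∀ S, 0 ≤ G S) (hGM : ∀ S, G S ≤ M)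
    (hη : ∀ S, S.card ≤ w → G S ≤ η) (hκ : ∀ S, 2 * w ≤ S.card → κ ≤ G S) (hκ0 : 0 ≤ κ) {p : ℝ}
    (hp0 : 0 ≤ p) (hp1 : p ≤ 1) :
    |∑ S, bernoulliWeight p S * G S| ≤ M ∧
    (p ≤ 1 / 100 * w / d → |∑ S, bernoulliWeight p S * G S| ≤ M * (1 / 32) ^ w + η) ∧
    (8 * w / d ≤ p → κ / 2 ≤ |∑ S, bernoulliWeight p S * G S|) := by
  have hd' : (0 : ℝ) < d := by exact_mod_cast hd
  have hW := fun S : Finset (Fin d) => bernoulliWeight_nonneg hp0 hp1 S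
  rw [abs_of_nonneg (Finset.sum_nonneg fun S _ => mul_nonneg (hW S) (hG0 S))]
  have hM0 : 0 ≤ M := (hG0 ∅).trans (hGM ∅)
  have hη0 : 0 ≤ η := (hG0 ∅).trans (hη ∅ (by simp))
  refine ⟨?_, fun hp => ?_, fun hp => ?_⟩
  · calc _ ≤ ∑ S : Finset (Fin d), bernoulliWeight p S * M :=
          Finset.sum_le_sum fun S _ => mul_le_mul_of_nonneg_left (hGM S) (hW S)
      _ = M := by rw [← Finset.sum_mul, sum_bernoulliWeight, one_mul]
  · have h := sum_bernoulliWeight_card_gt_le (ι := Fin d) (δ := 1 / 100) (w := w) hp0 hp1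
      (by norm_num) (by norm_num) (by rw [Fintype.card_fin]; exact (le_div_iff₀ hd').1 hp)
    have he : (Real.exp 1 * (1 / 100)) ^ w ≤ (1 / 32) ^ w := by
      have := Real.exp_one_lt_d9
      exact pow_le_pow_left₀ (by positivity) (by linarith) _
    calc _ ≤ ∑ S : Finset (Fin d), (M * (bernoulliWeight p S * (if w < S.card then 1 else 0)) +
            bernoulliWeight p S * η) := by
          refine Finset.sum_le_sum fun S _ => ?_
          have hWS := hW S
          split_ifs with hS
          · nlinarith [mul_le_mul_of_nonneg_left (hGM S) hWS, mul_nonneg hWS hη0]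
          · nlinarith [mul_le_mul_of_nonneg_left (hη S (not_lt.1 hS)) hWS]
      _ = M * ∑ S : Finset (Fin d), bernoulliWeight p S * (if w < S.card then 1 else 0) + η := by
          rw [Finset.sum_add_distrib, ← Finset.mul_sum, ← Finset.sum_mul, sum_bernoulliWeight,
            one_mul]
      _ ≤ _ := by gcongr; exact h.trans he
  · have h := sum_bernoulliWeight_card_lt_le (ι := Fin d) hp0 hp1 hw
      (by rw [Fintype.card_fin]; exact (div_le_iff₀ hd').1 hp)
    calc κ / 2 ≤ κ - κ * ∑ S : Finset (Fin d),
            bernoulliWeight p S * (if S.card < 2 * w then 1 else 0) := by nlinarith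
      _ = ∑ S : Finset (Fin d), (bernoulliWeight p S * κ -
            κ * (bernoulliWeight p S * (if S.card < 2 * w then 1 else 0))) := by
          rw [Finset.sum_sub_distrib, ← Finset.mul_sum, ← Finset.sum_mul, sum_bernoulliWeight,
            one_mul]
      _ ≤ _ := by
          refine Finset.sum_le_sum fun S _ => ?_
          have hWS := hW S
          split_ifs with hS
          · nlinarith [mul_nonneg hWS (hG0 S)]
          · nlinarith [mul_le_mul_of_nonneg_left (hκ S (not_lt.1 hS)) hWS]

/-- After multiplying by `2^m` and using `3200 ≤ 2^12`, the leading factor is `2^m * 2^(12m) * 2^m =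
2^(14m)`. It is absorbed by `32^-w` since `14m ≤ w`, and cancels `(2^-14)^m` exactly; hence both
constants `14`. -/
lemma lower_bound_numerics {m w : ℕ} (hw : 1 ≤ w) (hmw : 14 * m ≤ w) :
    (2 ^ m * (1 / 32) ^ w + 2 ^ m * (1 / 2 ^ 14) ^ (m + 1) +
        2 * 2 ^ m * (1 / 2 ^ 14) ^ (m + 1)) * 3200 ^ m +
      2 * 2 ^ m * (1 / 2 ^ 14) ^ (m + 1) < (1 / 2 : ℝ) ^ (m + 1) / 2 := by
  have h1 : (2 : ℝ) ^ (14 * m) * (1 / 32) ^ w ≤ 1 / 16 := by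
    calc (2 : ℝ) ^ (14 * m) * (1 / 32) ^ w ≤ 2 ^ w * (1 / 32) ^ w := by
          gcongr; norm_num
      _ = (1 / 16) ^ w := by rw [← mul_pow]; norm_num
      _ ≤ (1 / 16) ^ 1 := pow_le_pow_of_le_one (by norm_num) (by norm_num) hw
      _ = _ := pow_one _
  have h2 : (3200 : ℝ) ^ m ≤ (2 ^ 12) ^ m := by gcongr; norm_num
  have h3 : (2 : ℝ) ^ (14 * m) * (1 / 2 ^ 14) ^ m = 1 := by
    rw [pow_mul, ← mul_pow]; norm_num
  have h4 : (2 : ℝ) ^ (14 * m) = 2 ^ m * (2 ^ 12) ^ m * 2 ^ m := by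
    rw [← mul_pow, ← mul_pow, pow_mul]; norm_num
  have h5 : (2 : ℝ) ^ m * 2 ^ m ≤ 2 ^ (14 * m) := by
    rw [h4, mul_right_comm]
    exact le_mul_of_one_le_right (by positivity) (one_le_pow₀ (by norm_num))
  have h6 : (2 : ℝ) ^ m * 2 ^ m * (1 / 2 ^ 14) ^ m ≤ 1 := by
    refine le_trans ?_ h3.le
    gcongr
  have h7 : (2 : ℝ) ^ m * (1 / 2) ^ m = 1 := by rw [← mul_pow]; norm_num
  refine lt_of_mul_lt_mul_left ?_ (show (0 : ℝ) ≤ 2 ^ m by positivity)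
  calc _ ≤ 2 ^ m * ((2 ^ m * (1 / 32) ^ w + 2 ^ m * (1 / 2 ^ 14) ^ (m + 1) +
        2 * 2 ^ m * (1 / 2 ^ 14) ^ (m + 1)) * (2 ^ 12) ^ m +
      2 * 2 ^ m * (1 / 2 ^ 14) ^ (m + 1) : ℝ) := by gcongr
    _ = 2 ^ (14 * m) * (1 / 32) ^ w + 3 / 2 ^ 14 * (2 ^ (14 * m) * (1 / 2 ^ 14) ^ m) +
        2 / 2 ^ 14 * (2 ^ m * 2 ^ m * (1 / 2 ^ 14) ^ m) := by rw [h4]; ring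
    _ ≤ 1 / 16 + 3 / 2 ^ 14 * 1 + 2 / 2 ^ 14 * 1 := by rw [h3]; gcongr
    _ < 1 / 4 := by norm_num
    _ = 2 ^ m * (1 / 2) ^ m / 4 := by rw [h7]
    _ = _ := by ring

end QMAQuery

open QMAQuery Polynomial in
theorem mainTheorem9 :
    ∃ c : ℝ, 0 < c ∧ ∀ d w m T : ℕ, 1 ≤ w → 2 * w ≤ d →
      ∀ A : QMAQuery.Algorithm d m T,
        A.IsQMATester (QMAQuery.approxDimYes d w) (QMAQuery.approxDimNo d w) →
          c * (w : ℝ) ≤ (m : ℝ) ∨ c * Real.sqrt ((d : ℝ) / (w : ℝ)) ≤ (T : ℝ) := by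
  obtain ⟨f, hf, hno, hyes⟩ := exists_amplifying_polynomial
  set L := f.natDegree
  set c : ℝ := 1 / (2 ^ 12 * (L + 1)) with hc
  have hc0 : 0 < c := by positivity
  have hcL : c * L ≤ 1 / 2 ^ 12 := by
    rw [hc, one_div_mul_eq_div, div_le_div_iff₀ (by positivity) (by positivity)]
    nlinarith
  have hc1 : c ≤ 1 / 2 ^ 12 := by
    rw [hc]
    apply one_div_le_one_div_of_le (by positivity)
    have : (0 : ℝ) ≤ L := by positivity
    linarith
  refine ⟨c, hc0, fun d w m T hw hwd A hA => ?_⟩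
  by_contra! ⟨hm, hT⟩
  have hw0 : (0 : ℝ) < w := by exact_mod_cast hw
  have hd : 0 < d := by omega
  have hd0 : (0 : ℝ) < d := by exact_mod_cast hd
  have hT2 : (T : ℝ) ^ 2 ≤ c ^ 2 * (d / w) := by
    have h := pow_le_pow_left₀ (by positivity) hT.le 2
    rwa [mul_pow, Real.sq_sqrt (by positivity)] at h
  have hmw : 14 * m ≤ w := by
    have : (14 * m : ℝ) ≤ w := by nlinarith
    exact_mod_cast this
  -- This keeps `b` inside `[0, 1]`. If `d < 8w`, the bound on `T` would force `T = 0`, which is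
  -- impossible.
  have h8 : (8 * w : ℝ) ≤ d := by
    by_contra! h
    have h1 : (1 : ℝ) ≤ T := by exact_mod_cast Nat.one_le_iff_ne_zero.2 (hA.queries_ne_zero hwd)
    have h2 : (d : ℝ) / w ≤ 8 := (div_le_iff₀ hw0).2 h.le
    have h3 : c ^ 2 * (d / w) ≤ (1 / 2 ^ 12) ^ 2 * 8 := by gcongr
    nlinarith
  -- The power `m + 1` beats both `2^m` and the growth `3200^m`. It also makes the degree
  -- proportional to `m + 1`, so `m` cancels from the condition on `T`.
  obtain ⟨G, hG, hG0, hGM, hGno, hGyes⟩ := hA.exists_lowDegree hf hno hyes (m + 1)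
  obtain ⟨P, hPdeg, hP⟩ := exists_polynomial_real hG
  -- The mean size of `S` is `w/100` at `a` and `8w` at `b`, well outside the gap from `w` to `2w`.
  set a : ℝ := 1 / 100 * w / d with ha
  set b : ℝ := 8 * w / d with hb
  have ha0 : 0 < a := by positivity
  have hab : a ≤ b := by rw [ha, hb]; gcongr; norm_num
  have hb1 : b ≤ 1 := (div_le_one hd0).2 h8
  have hbounds := fun p (hp0 : 0 ≤ p) (hp1 : p ≤ 1) =>
    bernoulli_average_bounds hw hd hG0 hGM hGno hGyes (by positivity) hp0 hp1
  simp only [← hP] at hbounds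
  have hgrow := abs_eval_le_of_degree_le (m := m) (γ := 1 / 2 ^ 14) (a := a) (b := b) hPdeg
    (show (0 : ℝ) < 2 ^ m by positivity)
    (show (0 : ℝ) < 2 ^ m * (1 / 32) ^ w + 2 ^ m * (1 / 2 ^ 14) ^ (m + 1) by positivity)
    (by norm_num) (by norm_num) ha0 hab (fun x hx => (hbounds x hx.1 hx.2).1)
    (fun x hx => (hbounds x hx.1 (hx.2.trans (hab.trans hb1))).2.1 hx.2) (by
      push_cast
      calc 9 * (((m + 1 : ℝ) * L) * (2 * T)) ^ 2 * b
          = 288 * (m + 1) ^ 2 * L ^ 2 * (w / d) * T ^ 2 := by rw [hb]; ring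
        _ ≤ 288 * (m + 1) ^ 2 * L ^ 2 * (w / d) * (c ^ 2 * (d / w)) := by gcongr
        _ = 288 * (m + 1) ^ 2 * (c * L) ^ 2 := by field_simp
        _ ≤ 288 * (m + 1) ^ 2 * (1 / 2 ^ 12) ^ 2 := by gcongr
        _ ≤ 1 / 2 ^ 14 * (m + 1) ^ 2 := by nlinarith [sq_nonneg ((m : ℝ) + 1)])
  have hratio : 4 * b / a = 3200 := by rw [ha, hb]; field_simp; norm_num
  rw [hratio] at hgrow
  have hlow := (hbounds b (ha0.le.trans hab) hb1).2.2 le_rfl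
  exact absurd (hlow.trans hgrow) (not_le.2 (lower_bound_numerics hw hmw))
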